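/- Let $\mathbb G$ be a Carnot group: a connected, simply connected Lie group whose Lie algebra of left-invariant vector fields splits as $\mathfrak g=\mathfrak g_1\oplus\dots\oplus\mathfrak g_m$ with $[\mathfrak g_1,\mathfrak g_i]=\mathfrak g_{i+1}$ for $i<m$ and $[\mathfrak g_1,\mathfrak g_m]=0$. Fix an inner product on $\mathfrak g$, an orthonormal basis $X_1,\dots,X_n$ of $\mathfrak g_1$ and a Haar measure $dx$ on $\mathbb G$. Let $\Omega\subset\mathbb G$ be a domain (a nonempty connected open set) and $(Y,d)$ a metric space. The space $L^1_\infty(\Omega)$ consists of all locally summable $u:\Omega\to\mathbb R$ having generalized derivatives $X_1u,\dots,X_nu\in L_\infty(\Omega)$, i.e. $\int_\Omega (X_ju)\,v\,dx=-\int_\Omega u\,X_jv\,dx$ for all $v\in C_0^\infty(\Omega)$; put $\nabla_hu=(X_1u,\dots,X_nu)$ and $\|u\mid L^1_\infty(\Omega)\|=\operatorname{ess\,sup}_\Omega|\nabla_hu|$. Let ${\rm Lip}(Y)$ be the space of Lipschitz functions $u:Y\to\mathbb R$ with the seminorm ${\rm Lip}(u)=\sup_{y_1\ne y_2}|u(y_1)-u(y_2)|/d(y_1,y_2)$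 (equal to $0$ if $Y$ is a single point). A mapping $\varphi:\Omega\to Y$ induces a bounded operator $\varphi^*:{\rm Lip}(Y)\to L^1_\infty(\Omega)$, $\varphi^*u=u\circ\varphi$, if $u\circ\varphi\in L^1_\infty(\Omega)$ for all $u\in{\rm Lip}(Y)$ and $\|u\circ\varphi\mid L^1_\infty(\Omega)\|\le K\,{\rm Lip}(u)$ for all $u\in{\rm Lip}(Y)$ with some constant $K<\infty$; $\|\varphi^*\|$ is the infimum of such $K\ge 0$. A mapping $\varphi:\Omega\to Y$ belongs to the Reshetnyak class $L^1_\infty(\Omega;Y)$ if preimages of Borel sets under $\varphi$ are measurable, $u\circ\varphi\in L^1_\infty(\Omega)$ for all $u\in{\rm Lip}(Y)$, and there is $0\le g\in L_\infty(\Omega)$ with $|\nabla_h(u\circ\varphi)|\le{\rm Lip}(u)\,g$ a.e. in $\Omega$ for every $u\in{\rm Lip}(Y)$. The upper gradient $|\nabla_0\varphi|$ is the a.e. smallest such $g$. **Proposition.** If a mapping $\varphi:\Omega\to Y$ induces a bounded operator $\varphi^*:{\rm Lip}(Y)\to L^1_\infty(\Omega)$, then $\varphi\in L^1_\infty(\Omega;Y)$.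 Moreover, the upper gradient $|\nabla_0\varphi|$ exists and $\|\,|\nabla_0\varphi|\mid L_\infty(\Omega)\|=\|\varphi^*\|$. -/

import Mathlib

open MeasureTheory Set Filter Topology
open scoped Manifold ContDiff ENNReal NNReal

noncomputable section

/-- A stratification of (the Lie algebra of) a Lie group `G`, together with an inner product on the
Lie algebra and an orthonormal basis of the horizontal space. The Lie algebra `𝔤` is Mathlib's
`GroupLieAlgebra`: the tangent space at `1` with the bracket of left-invariant vector fields.
The layers `𝔤₁, …, 𝔤ₘ` are `layer 0, …, layer s` with `m = s + 1`. -/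
structure CarnotStructure (E : Type*) [NormedAddCommGroup E] [NormedSpace ℝ E]
    (G : Type*) [TopologicalSpace G] [ChartedSpace E G] [Group G] where
  /-- number of layers minus one -/
  s : ℕ
  /-- the layers -/
  layer : Fin (s + 1) → Submodule ℝ (GroupLieAlgebra 𝓘(ℝ, E) G)
  /-- `𝔤` is the direct sum of the layers -/
  isInternal : DirectSum.IsInternal layer
  /-- `[𝔤₁, 𝔤ᵢ] = 𝔤ᵢ₊₁` for `i < m` -/
  bracket_succ : ∀ i : Fin s,
    Submodule.span ℝ {z | ∃ x ∈ layer 0, ∃ y ∈ layer i.castSucc, z = ⁅x, y⁆} = layer i.succ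
  /-- `[𝔤₁, 𝔤ₘ] = 0` -/
  bracket_last : ∀ x ∈ layer 0, ∀ y ∈ layer (Fin.last s), ⁅x, y⁆ = 0
  /-- the fixed inner product on `𝔤` -/
  ip : InnerProductSpace.Core ℝ (GroupLieAlgebra 𝓘(ℝ, E) G)
  /-- dimension of the horizontal space -/
  n : ℕ
  /-- the basis `X₁, …, Xₙ` of the horizontal space `𝔤₁` -/
  X : Module.Basis (Fin n) ℝ (layer 0)
  /-- the basis is orthonormal -/
  orthonormal : ∀ i j, ip.inner (X i : GroupLieAlgebra 𝓘(ℝ, E) G) (X j) = if i = j then 1 else 0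

section Sobolev

variable {E : Type*} [NormedAddCommGroup E] [NormedSpace ℝ E]
  {G : Type*} [TopologicalSpace G] [ChartedSpace E G] [Group G]

/-- The derivative `X_j v` of a (smooth) function along the left-invariant field `X_j`. -/
def CarnotStructure.fieldDeriv (C : CarnotStructure E G) (j : Fin C.n) (v : G → ℝ) (x : G) : ℝ :=
  mfderiv 𝓘(ℝ, E) 𝓘(ℝ, ℝ) v x
    (mulInvariantVectorField (C.X j : GroupLieAlgebra 𝓘(ℝ, E) G) x)

variable [MeasurableSpace G]

/-! Functions and mappings on `Ω` are represented by functions on `G`, of which only the values on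
`Ω` matter. -/

/-- The vector function `g` is a generalized horizontal gradient of `u` on `Ω`: each component is
locally summable in `Ω` and is the generalized derivative of `u` along `X_j`, tested against
`v ∈ C₀^∞(Ω)`. -/
def IsWeakHGrad (C : CarnotStructure E G) (μ : Measure G) (Ω : Set G) (u : G → ℝ)
    (g : G → EuclideanSpace ℝ (Fin C.n)) : Prop :=
  ∀ j : Fin C.n, LocallyIntegrableOn (fun x => g x j) Ω μ ∧
    ∀ v : G → ℝ, ContMDiff 𝓘(ℝ, E) 𝓘(ℝ, ℝ) ∞ v → HasCompactSupport v → tsupport v ⊆ Ω →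
      ∫ x in Ω, g x j * v x ∂μ = - ∫ x in Ω, u x * C.fieldDeriv j v x ∂μ

/-- The space `L¹_p(Ω)`: locally summable functions whose generalized derivatives along
`X₁, …, Xₙ` belong to `L_p(Ω)`. -/
def MemL1 (C : CarnotStructure E G) (μ : Measure G) (Ω : Set G) (p : ℝ≥0∞) (u : G → ℝ) : Prop :=
  LocallyIntegrableOn u Ω μ ∧ ∃ g : G → EuclideanSpace ℝ (Fin C.n),
    IsWeakHGrad C μ Ω u g ∧ ∀ j, MemLp (fun x => g x j) p (μ.restrict Ω)

open Classical in
/-- The horizontal gradient `∇_h u` (a representative; it is unique a.e. in `Ω`). -/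
def hGrad (C : CarnotStructure E G) (μ : Measure G) (Ω : Set G) (u : G → ℝ) :
    G → EuclideanSpace ℝ (Fin C.n) :=
  if h : ∃ g, IsWeakHGrad C μ Ω u g then h.choose else 0

/-- The seminorm `‖u | L¹_p(Ω)‖ = ‖ |∇_h u| | L_p(Ω)‖`, used for `u ∈ L¹_p(Ω)`. -/
def l1Seminorm (C : CarnotStructure E G) (μ : Measure G) (Ω : Set G) (p : ℝ≥0∞) (u : G → ℝ) :
    ℝ≥0∞ :=
  eLpNorm (fun x => ‖hGrad C μ Ω u x‖) p (μ.restrict Ω)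

variable {Y : Type*} [MetricSpace Y]

/-- `u ∈ Lip(Y)`. -/
def IsLip (u : Y → ℝ) : Prop := ∃ K : ℝ≥0, LipschitzWith K u

/-- `Lip(u) = sup_{y₁ ≠ y₂} |u(y₁) - u(y₂)| / d(y₁, y₂)`; it equals `0` on a one-point space. -/
def lipConst (u : Y → ℝ) : ℝ :=
  ⨆ q : {q : Y × Y // q.1 ≠ q.2}, |u q.1.1 - u q.1.2| / dist q.1.1 q.1.2

/-- The constant `K` bounds the composition operator `u ↦ u ∘ φ` from `Lip(Y)` to `L¹_p(Ω)`. -/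
def IsCompBound (C : CarnotStructure E G) (μ : Measure G) (Ω : Set G) (p : ℝ≥0∞) (φ : G → Y)
    (K : ℝ≥0) : Prop :=
  ∀ u : Y → ℝ, IsLip u → l1Seminorm C μ Ω p (u ∘ φ) ≤ K * ENNReal.ofReal (lipConst u)

/-- `φ` induces the bounded composition operator `φ* : Lip(Y) → L¹_p(Ω)`, `φ* u = u ∘ φ`. -/
def InducesBoundedComp (C : CarnotStructure E G) (μ : Measure G) (Ω : Set G) (p : ℝ≥0∞)
    (φ : G → Y) : Prop :=
  (∀ u : Y → ℝ, IsLip u → MemL1 C μ Ω p (u ∘ φ)) ∧ ∃ K : ℝ≥0, IsCompBound C μ Ω p φ K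

/-- The operator norm `‖φ*‖`: the infimum of the bounds of the operator. -/
def compNorm (C : CarnotStructure E G) (μ : Measure G) (Ω : Set G) (p : ℝ≥0∞) (φ : G → Y) :
    ℝ≥0∞ :=
  ⨅ (K : ℝ≥0) (_ : IsCompBound C μ Ω p φ K), (K : ℝ≥0∞)

/-- `0 ≤ g ∈ L_p(Ω)` satisfies `|∇_h (u ∘ φ)| ≤ Lip(u) g` a.e. in `Ω` for every `u ∈ Lip(Y)`.
The requirement `0 ≤ g` is automatic as soon as `Y` has two points. -/
def IsGradMajorant (C : CarnotStructure E G) (μ : Measure G) (Ω : Set G) (p : ℝ≥0∞) (φ : G → Y)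
    (g : G → ℝ) : Prop :=
  MemLp g p (μ.restrict Ω) ∧ (∀ᵐ x ∂μ.restrict Ω, 0 ≤ g x) ∧
    ∀ u : Y → ℝ, IsLip u →
      ∀ᵐ x ∂μ.restrict Ω, ‖hGrad C μ Ω (u ∘ φ) x‖ ≤ lipConst u * g x

/-- The Reshetnyak class `L¹_p(Ω; Y)`. Measurability of `φ` on `Ω` means that preimages of Borel
sets are measurable for the completed measure. -/
def MemReshetnyak (C : CarnotStructure E G) (μ : Measure G) (Ω : Set G) (p : ℝ≥0∞)
    [MeasurableSpace Y] (φ : G → Y) : Prop :=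
  NullMeasurable φ (μ.restrict Ω) ∧
    (∀ u : Y → ℝ, IsLip u → MemL1 C μ Ω p (u ∘ φ)) ∧
    ∃ g, IsGradMajorant C μ Ω p φ g

/-- `g` is (a representative of) the upper gradient `|∇₀ φ|` of `φ ∈ L¹_p(Ω; Y)`: the a.e. minimal
function among the majorants. -/
def IsUpperGradient (C : CarnotStructure E G) (μ : Measure G) (Ω : Set G) (p : ℝ≥0∞) (φ : G → Y)
    (g : G → ℝ) : Prop :=
  IsGradMajorant C μ Ω p φ g ∧
    ∀ g', IsGradMajorant C μ Ω p φ g' → ∀ᵐ x ∂μ.restrict Ω, g x ≤ g' x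

end Sobolev

end

/-! For p = ∞ a constant `K` bounds `φ*` exactly when the constant function `K` is a majorant, so
boundedness of `φ*` supplies a majorant. Majorants are closed under countable infima, since each `u`
is tested separately and countably many null sets may be discarded. Hence their essential infimum is
again a majorant, and it is the upper gradient. It lies below every constant bound, while its own
essential supremum is a bound, which gives the norm equality. Measurability follows by testing `φ`
with distance functions to closed sets. -/

section GradMajorant

/-- A nonempty family of a.e. nonnegative essentially bounded functions that is closed under
countable infima has an a.e. smallest member. -/
theorem exists_ae_minimal_of_iInf_mem {α : Type*} [MeasurableSpace α] (ν : Measure α) [SFinite ν]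
    (S : Set (α → ℝ)) (hne : S.Nonempty) (hmem : ∀ g ∈ S, MemLp g (∞ : ℝ≥0∞) ν)
    (hnn : ∀ g ∈ S, ∀ᵐ x ∂ν, 0 ≤ g x)
    (hinf : ∀ f : ℕ → α → ℝ, (∀ n, f n ∈ S) → (fun x => ⨅ n, f n x) ∈ S) :
    ∃ g ∈ S, ∀ g' ∈ S, ∀ᵐ x ∂ν, g x ≤ g' x := by
  have hac : ν.toFinite ≪ ν := toFinite_absolutelyContinuous ν
  have hca : ν ≪ ν.toFinite := absolutelyContinuous_toFinite ν
  -- A real infimum lies below its terms only when they are bounded below; a.e. nonnegativity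
  -- ensures this.
  have hle : ∀ f : ℕ → α → ℝ, (∀ n, f n ∈ S) → ∀ᵐ x ∂ν, ∀ n, (⨅ k, f k x) ≤ f n x := by
    intro f hf
    filter_upwards [ae_all_iff.2 fun n => hnn _ (hf n)] with x hx n
    exact ciInf_le ⟨0, by rintro _ ⟨k, rfl⟩; exact hx k⟩ n
  -- Integrating against a finite measure with the same null sets makes `I` finite on `S`. The
  -- infimum of a minimizing sequence then minimizes `I`.
  let I : (α → ℝ) → ℝ≥0∞ := fun g => ∫⁻ x, ENNReal.ofReal (g x) ∂ν.toFinite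
  have hfin : ∀ g ∈ S, I g ≠ ⊤ := by
    intro g hg
    have h1 : MemLp g (∞ : ℝ≥0∞) ν.toFinite := by
      refine ⟨(hmem g hg).1.mono_ac hac, lt_of_le_of_lt ?_ (hmem g hg).2⟩
      rw [eLpNorm_exponent_top, eLpNorm_exponent_top]
      exact eLpNormEssSup_mono_measure g hac
    have h2 : Integrable g ν.toFinite := h1.integrable le_top
    exact h2.lintegral_lt_top.ne
  obtain ⟨w, -, hw, hwS⟩ := exists_seq_tendsto_sInf (hne.image I) (OrderBot.bddBelow _)
  choose f hf hfw using hwS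
  refine ⟨fun x => ⨅ n, f n x, hinf f hf, fun g' hg' => ?_⟩
  have hIle : I (fun x => ⨅ n, f n x) ≤ sInf (I '' S) := by
    refine ge_of_tendsto' hw fun n => ?_
    rw [← hfw n]
    refine lintegral_mono_ae ?_
    filter_upwards [hac.ae_le (hle f hf)] with x hx
    exact ENNReal.ofReal_le_ofReal (hx n)
  -- The infimum of this sequence is the minimum of the candidate and `g'`. It cannot have a smaller
  -- integral than the candidate, so the two agree a.e.
  let p : ℕ → α → ℝ := fun k => if k = 0 then (fun x => ⨅ n, f n x) else g'
  have hp : ∀ k, p k ∈ S := by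
    intro k
    by_cases hk : k = 0
    · simpa [p, hk] using hinf f hf
    · simpa [p, hk] using hg'
  have hpS := hinf p hp
  have hpa : ∀ᵐ x ∂ν, (⨅ k, p k x) ≤ ⨅ n, f n x := by
    filter_upwards [hle p hp] with x hx
    simpa only [p, if_true] using hx 0
  have hpb : ∀ᵐ x ∂ν, (⨅ k, p k x) ≤ g' x := by
    filter_upwards [hle p hp] with x hx
    simpa only [p, one_ne_zero, if_false] using hx 1
  have heq : (fun x => ENNReal.ofReal (⨅ k, p k x)) =ᵐ[ν.toFinite]
      fun x => ENNReal.ofReal (⨅ n, f n x) := by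
    refine ae_eq_of_ae_le_of_lintegral_le ?_ (hfin _ hpS) ?_ ?_
    · filter_upwards [hac.ae_le hpa] with x hx
      exact ENNReal.ofReal_le_ofReal hx
    · exact ((hmem _ (hinf f hf)).1.mono_ac hac).aemeasurable.ennreal_ofReal
    · exact hIle.trans (sInf_le ⟨_, hpS, rfl⟩)
  filter_upwards [hca.ae_le heq, hpb, hnn _ hpS, hnn _ (hinf f hf)] with x h1 h2 h3 h4
  rw [ENNReal.ofReal_eq_ofReal_iff h3 h4] at h1
  exact h1 ▸ h2

/-- A map into a metric space is a.e. measurable in the sense of null measurability as soon as its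
compositions with Lipschitz functions are; separability of the target is not needed. -/
theorem nullMeasurable_of_aemeasurable_lipschitz_comp {α Y : Type*} [MeasurableSpace α]
    [MetricSpace Y] [MeasurableSpace Y] [BorelSpace Y] {ν : Measure α} {φ : α → Y}
    (h : ∀ u : Y → ℝ, IsLip u → AEMeasurable (u ∘ φ) ν) : NullMeasurable φ ν := by
  intro s hs
  rw [BorelSpace.measurable_eq (α := Y), borel_eq_generateFrom_isClosed] at hs
  induction s, hs using MeasurableSpace.generateFrom_induction with
  | hC t ht _ =>
    have ht : IsClosed t := ht
    -- `infDist` to the empty set is 0 everywhere, so this case is separate.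
    rcases t.eq_empty_or_nonempty with rfl | hne
    · simp
    have hpre : φ ⁻¹' t = ((fun y => Metric.infDist y t) ∘ φ) ⁻¹' {0} := by
      ext x
      simp [ht.mem_iff_infDist_zero hne]
    rw [hpre]
    exact (h _ ⟨1, Metric.lipschitz_infDist_pt t⟩).nullMeasurable (measurableSet_singleton 0)
  | empty => simp
  | compl t _ ih => exact ih.compl
  | iUnion t _ ih => rw [preimage_iUnion]; exact NullMeasurableSet.iUnion ih

theorem lipConst_nonneg {Y : Type*} [MetricSpace Y] (u : Y → ℝ) : 0 ≤ lipConst u :=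
  Real.iSup_nonneg fun _ => by positivity

variable {E : Type*} [NormedAddCommGroup E] [NormedSpace ℝ E]
  {G : Type*} [TopologicalSpace G] [ChartedSpace E G] [Group G] [MeasurableSpace G]
  {C : CarnotStructure E G} {μ : Measure G} {Ω : Set G} {Y : Type*} [MetricSpace Y] {φ : G → Y}

theorem IsCompBound.isGradMajorant_const {K : ℝ≥0} (hK : IsCompBound C μ Ω ∞ φ K) :
    IsGradMajorant C μ Ω ∞ φ fun _ => (K : ℝ) := by
  refine ⟨memLp_top_const _, ae_of_all _ fun _ => K.2, fun u hu => ?_⟩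
  have h := hK u hu
  rw [l1Seminorm, eLpNorm_exponent_top] at h
  filter_upwards [ae_le_eLpNormEssSup (f := fun x => ‖hGrad C μ Ω (u ∘ φ) x‖)
    (μ := μ.restrict Ω)] with x hx
  have h2 := hx.trans h
  rw [enorm_norm, ← ofReal_norm, ← ENNReal.ofReal_coe_nnreal,
    ← ENNReal.ofReal_mul K.coe_nonneg] at h2
  rw [mul_comm]
  exact (ENNReal.ofReal_le_ofReal_iff (mul_nonneg K.coe_nonneg (lipConst_nonneg u))).1 h2

theorem IsGradMajorant.isCompBound {g : G → ℝ} (hg : IsGradMajorant C μ Ω ∞ φ g) :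
    IsCompBound C μ Ω ∞ φ (eLpNorm g ∞ (μ.restrict Ω)).toNNReal := by
  intro u hu
  rw [ENNReal.coe_toNNReal hg.1.eLpNorm_ne_top, l1Seminorm, eLpNorm_exponent_top,
    eLpNorm_exponent_top]
  refine eLpNormEssSup_le_of_ae_enorm_bound ?_
  filter_upwards [hg.2.2 u hu, ae_le_eLpNormEssSup (f := g) (μ := μ.restrict Ω), hg.2.1]
    with x h1 h2 h3
  rw [enorm_norm, ← ofReal_norm]
  calc ENNReal.ofReal ‖hGrad C μ Ω (u ∘ φ) x‖ ≤ ENNReal.ofReal (lipConst u * g x) :=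
        ENNReal.ofReal_le_ofReal h1
    _ = ‖g x‖ₑ * ENNReal.ofReal (lipConst u) := by
        rw [ENNReal.ofReal_mul (lipConst_nonneg u), mul_comm, Real.enorm_of_nonneg h3]
    _ ≤ _ := by gcongr

theorem IsGradMajorant.iInf {f : ℕ → G → ℝ} (hf : ∀ n, IsGradMajorant C μ Ω ∞ φ (f n)) :
    IsGradMajorant C μ Ω ∞ φ fun x => ⨅ n, f n x := by
  have hnn : ∀ᵐ x ∂μ.restrict Ω, ∀ n, 0 ≤ f n x := ae_all_iff.2 fun n => (hf n).2.1
  refine ⟨(hf 0).1.mono ?_ ?_, ?_, fun u hu => ?_⟩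
  · exact (AEMeasurable.iInf fun n =>
      (hf n).1.aestronglyMeasurable.aemeasurable).aestronglyMeasurable
  · filter_upwards [hnn] with x hx
    rw [Real.norm_of_nonneg (Real.iInf_nonneg hx), Real.norm_of_nonneg (hx 0)]
    exact ciInf_le ⟨0, by rintro _ ⟨k, rfl⟩; exact hx k⟩ 0
  · filter_upwards [hnn] with x hx using Real.iInf_nonneg hx
  · filter_upwards [ae_all_iff.2 fun n => (hf n).2.2 u hu] with x hx
    rw [Real.mul_iInf_of_nonneg (lipConst_nonneg u)]
    exact le_ciInf hx

theorem IsUpperGradient.eLpNorm_eq_compNorm {g : G → ℝ} (hg : IsUpperGradient C μ Ω ∞ φ g) :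
    eLpNorm g ∞ (μ.restrict Ω) = compNorm C μ Ω ∞ φ := by
  refine le_antisymm (le_iInf₂ fun K hK => ?_) ?_
  · rw [eLpNorm_exponent_top]
    refine eLpNormEssSup_le_of_ae_enorm_bound ?_
    filter_upwards [hg.2 _ hK.isGradMajorant_const, hg.1.2.1] with x h1 h2
    rw [Real.enorm_of_nonneg h2, ← ENNReal.ofReal_coe_nnreal]
    exact ENNReal.ofReal_le_ofReal h1
  · refine (iInf₂_le _ hg.1.isCompBound).trans ?_
    rw [ENNReal.coe_toNNReal hg.1.1.eLpNorm_ne_top]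

end GradMajorant

theorem proposition4p5
    {E : Type*} [NormedAddCommGroup E] [NormedSpace ℝ E] [FiniteDimensional ℝ E]
    {G : Type*} [TopologicalSpace G] [ChartedSpace E G] [Group G] [LieGroup 𝓘(ℝ, E) ∞ G]
    [T2Space G] [SecondCountableTopology G] [SimplyConnectedSpace G]
    (C : CarnotStructure E G)
    [MeasurableSpace G] [BorelSpace G] (μ : Measure G) [μ.IsHaarMeasure]
    (Ω : Set G) (hΩ : IsOpen Ω) (hΩc : IsConnected Ω)
    {Y : Type*} [MetricSpace Y] [MeasurableSpace Y] [BorelSpace Y]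
    (φ : G → Y) (hφ : InducesBoundedComp C μ Ω ∞ φ) :
    MemReshetnyak C μ Ω ∞ φ ∧
      (∃ g, IsUpperGradient C μ Ω ∞ φ g) ∧
      ∀ g, IsUpperGradient C μ Ω ∞ φ g →
        eLpNorm g ∞ (μ.restrict Ω) = compNorm C μ Ω ∞ φ := by
  obtain ⟨hmem, K, hK⟩ := hφ
  -- With second countability this makes Haar measure σ-finite, which gives the `SFinite` instance
  -- for the essential infimum.
  have : LocallyCompactSpace G := Manifold.locallyCompact_of_finiteDimensional 𝓘(ℝ, E)
  refine ⟨⟨nullMeasurable_of_aemeasurable_lipschitz_comp fun u hu =>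
    (hmem u hu).1.aestronglyMeasurable.aemeasurable, hmem, _, hK.isGradMajorant_const⟩, ?_,
    fun g hg => hg.eLpNorm_eq_compNorm⟩
  exact exists_ae_minimal_of_iInf_mem (μ.restrict Ω) {g | IsGradMajorant C μ Ω ∞ φ g}
    ⟨_, hK.isGradMajorant_const⟩ (fun g hg => hg.1) (fun g hg => hg.2.1)
    fun f hf => IsGradMajorant.iInf hf
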